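/- **Conventions.** A *preordered semiring* is a commutative semiring $S$ with a preorder $\le$ such that $x\le y$ implies $a+x\le a+y$ and $ax\le ay$ for all $a,x,y\in S$. It is a *preordered semidomain* if moreover $1\neq 0$, $xy=0$ implies $x=0$ or $y=0$, and $x\le 0\le x$ implies $x=0$. It is *zerosumfree* if $x+y=0$ implies $x=y=0$. An element $u\in S$ is *power universal* if $u\ge 1$ and for all nonzero $x\le y$ in $S$ there is $k\in\mathbb N$ with $y\le u^kx$. Let $\mathbb R_+$ be the semiring of nonnegative reals, $\mathbb{TR}_+=(\mathbb R_+,\max,\cdot)$ the tropical reals, both with their usual order, and let $T^{\mathrm{op}}$ denote $T$ with reversed order. A *spectral homomorphism* is a monotone semiring homomorphism $\varphi$ with $\varphi^{-1}(0)=\{0\}$ from $S$ into one of $\mathbb R_+$, $\mathbb R_+^{\mathrm{op}}$, $\mathbb{TR}_+$, $\mathbb{TR}_+^{\mathrm{op}}$ (inequalities between values are taken in the order of the codomain). It is *trivial* if it sends every nonzero element to $1$ (this can only happen for $\mathbb{TR}_+$ and $\mathbb{TR}_+^{\mathrm{op}}$). **Theorem.** Let $S$ be a zerosumfree preordered semidomain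 with a nonzero power universal element $u\in S$, and let $x,y\in S$ be nonzero. * Suppose that $ax\le ay$ for some nonzero $a\in S$, or that $u^kx^n\le u^ky^n$ for some $k\in\mathbb N$ and $n\ge 1$. Then $\varphi(x)\le\varphi(y)$ for all spectral homomorphisms $\varphi$. * Conversely, suppose that for every nonzero $z\in S$ there is $k\in\mathbb N$ with $z\le u^k$ and $1\le u^kz$ (this is automatic if $0\le 1$ or $1\le 0$ in $S$), and that $\varphi(x)<\varphi(y)$ for all nontrivial spectral homomorphisms $\varphi$. Then: 1. There is $k\in\mathbb N$ such that $u^kx^n\le u^ky^n$ for all sufficiently large $n$. 2. If $y$ is power universal as well, then $x^n\le y^n$ for all sufficiently large $n$. 3. There is a nonzero $a\in S$ with $ax\le ay$. Moreover, there is $k\in\mathbb N$ such that for all sufficiently large $n$ the element $a:=u^k\sum_{j=0}^{n}x^jy^{n-j}$ is nonzero and satisfies $ax\le ay$. -/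

import Mathlib

open scoped NNReal

/-- A preordered semiring: a commutative semiring with a preorder (not necessarily antisymmetric,
and with no assumed relation between `0` and `1`) for which adding and multiplying by an arbitrary
element is monotone. -/
class IsPreorderedSemiring (S : Type*) [CommSemiring S] [Preorder S] : Prop where
  add_le_add_left' : ∀ a x y : S, x ≤ y → a + x ≤ a + y
  mul_le_mul_left' : ∀ a x y : S, x ≤ y → a * x ≤ a * y

/-- A preordered semidomain: a preordered semiring without zero divisors, with `1 ≠ 0`, and in
which only `0` is order-equivalent to `0`. -/
class IsPreorderedSemidomain (S : Type*) [CommSemiring S] [Preorder S] : Prop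
    extends IsPreorderedSemiring S where
  eq_zero_or_eq_zero : ∀ x y : S, x * y = 0 → x = 0 ∨ y = 0
  one_ne_zero' : (1 : S) ≠ 0
  eq_zero_of_equiv_zero : ∀ x : S, x ≤ 0 → 0 ≤ x → x = 0

/-- A semiring is zerosumfree if a sum vanishes only when both summands do. -/
def IsZerosumfree (S : Type*) [CommSemiring S] : Prop :=
  ∀ x y : S, x + y = 0 → x = 0 ∧ y = 0

/-- `u` is power universal: `u ≥ 1`, and for all nonzero `x ≤ y` some power of `u` satisfies
`y ≤ u ^ k * x`. -/
def IsPowerUniversal {S : Type*} [CommSemiring S] [Preorder S] (u : S) : Prop :=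
  1 ≤ u ∧ ∀ x y : S, x ≠ 0 → y ≠ 0 → x ≤ y → ∃ k : ℕ, y ≤ u ^ k * x

/-- The tropical semifield in its multiplicative picture: nonnegative reals with `max` as addition
and the usual multiplication. -/
@[ext]
structure TropReal where
  val : ℝ≥0

namespace TropReal

theorem val_injective : Function.Injective val := fun _ _ h => TropReal.ext h

noncomputable instance : LinearOrder TropReal := LinearOrder.lift' val val_injective

instance : Zero TropReal := ⟨⟨0⟩⟩

instance : One TropReal := ⟨⟨1⟩⟩

noncomputable instance : Add TropReal := ⟨fun a b => ⟨max a.val b.val⟩⟩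

noncomputable instance : Mul TropReal := ⟨fun a b => ⟨a.val * b.val⟩⟩

@[simp] theorem val_zero : (0 : TropReal).val = 0 := rfl

@[simp] theorem val_one : (1 : TropReal).val = 1 := rfl

@[simp] theorem val_add (a b : TropReal) : (a + b).val = max a.val b.val := rfl

@[simp] theorem val_mul (a b : TropReal) : (a * b).val = a.val * b.val := rfl

theorem le_def (a b : TropReal) : a ≤ b ↔ a.val ≤ b.val := Iff.rfl

noncomputable instance : CommSemiring TropReal where
  add_assoc a b c := by ext1; simp [max_assoc]
  zero_add a := by ext1; simp
  add_zero a := by ext1; simp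
  add_comm a b := by ext1; simp [max_comm]
  left_distrib a b c := by ext1; simp [mul_max_of_nonneg]
  right_distrib a b c := by ext1; simp [max_mul_of_nonneg]
  zero_mul a := by ext1; simp
  mul_zero a := by ext1; simp
  mul_assoc a b c := by ext1; simp [mul_assoc]
  one_mul a := by ext1; simp
  mul_one a := by ext1; simp
  mul_comm a b := by ext1; simp [mul_comm]
  nsmul := nsmulRec

end TropReal

/-- `φ` is a monotone homomorphism of preordered semirings with `φ⁻¹(0) = {0}`. The opposite of a
preordered semiring `T` is the order dual `Tᵒᵈ`, which has the same operations. -/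
structure IsSpectralHom {S T : Type*} [CommSemiring S] [Preorder S] [CommSemiring T] [Preorder T]
    (φ : S →+* T) : Prop where
  monotone : Monotone φ
  eq_zero_of_map_eq_zero : ∀ s : S, φ s = 0 → s = 0

/-- `φ` maps every nonzero element to `1`, i.e. it factors through the Boolean semifield. -/
def IsTrivialHom {S T : Type*} [CommSemiring S] [CommSemiring T] (φ : S →+* T) : Prop :=
  ∀ s : S, s ≠ 0 → φ s = 1

/-- `φ x ≤ φ y` for all monotone homomorphisms with trivial kernel into the nonnegative reals, the
tropical reals, or the opposite of either. -/
def SpectralLE {S : Type*} [CommSemiring S] [Preorder S] (x y : S) : Prop :=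
  (∀ φ : S →+* ℝ≥0, IsSpectralHom φ → φ x ≤ φ y) ∧
  (∀ φ : S →+* ℝ≥0ᵒᵈ, IsSpectralHom φ → φ x ≤ φ y) ∧
  (∀ φ : S →+* TropReal, IsSpectralHom φ → φ x ≤ φ y) ∧
  (∀ φ : S →+* TropRealᵒᵈ, IsSpectralHom φ → φ x ≤ φ y)

/-- `φ x < φ y` for all monotone homomorphisms with trivial kernel into the nonnegative reals, the
tropical reals, or the opposite of either, except for the trivial homomorphism. (No homomorphism
into the nonnegative reals is trivial, as `1 + 1 ≠ 1` there.) -/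
def SpectralLT {S : Type*} [CommSemiring S] [Preorder S] (x y : S) : Prop :=
  (∀ φ : S →+* ℝ≥0, IsSpectralHom φ → φ x < φ y) ∧
  (∀ φ : S →+* ℝ≥0ᵒᵈ, IsSpectralHom φ → φ x < φ y) ∧
  (∀ φ : S →+* TropReal, IsSpectralHom φ → ¬ IsTrivialHom φ → φ x < φ y) ∧
  (∀ φ : S →+* TropRealᵒᵈ, IsSpectralHom φ → ¬ IsTrivialHom φ → φ x < φ y)

/-! The core is an algebraic Positivstellensatz by separation. Order `S` by `c * a ≤ c * b` for some
nonzero `c`; this is a cancellative preorder. If `u * x ^ n ≤ y ^ n` fails in it for every `n ≥ 1`,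
Zorn's lemma gives a maximal cancellative extension with the same failure, and maximality makes it
total on nonzero elements (`exists_total_extension`): were `s`, `t` incomparable, adjoining either
`t ≤ s` or `s ≤ t` would create such an inequality, and a divided-difference identity shows that
what holds in both extensions already held (`rel_of_extend_of_extend`). A total preorder with order
unit `u` has an Archimedean coarsening given by a real logarithm `l` (`exists_isLogHom`). The sign
of `l 2` decides its type: `exp (c * l)` is additive if `l 2 > 0`, the same for `-l` if `l 2 < 0`,
and addition is always max or always min if `l 2 = 0`. So `l` comes from a nontrivial spectral
homomorphism with `φ y ≤ φ x`, a contradiction. Hence `a * (u * x ^ m) ≤ a * y ^ m` for some `m ≥ 1`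
and nonzero `a`. Iterating multiplies the slack `u` while the cost of removing `a` stays fixed
(`exists_eventually_pow_mul_pow_le`), which yields the asymptotic claims; the explicit catalyst
comes from a telescoping sum. -/

/-- A preorder on a semiring, given as a relation, that is compatible with addition and
multiplication and for which multiplication by nonzero elements can be cancelled. -/
structure IsCancelPreorder {S : Type*} [CommSemiring S] (r : S → S → Prop) : Prop where
  refl : ∀ a, r a a
  trans : ∀ {a b c}, r a b → r b c → r a c
  add_right : ∀ c {a b}, r a b → r (a + c) (b + c)
  mul_left : ∀ c {a b}, r a b → r (c * a) (c * b)
  cancel : ∀ {c a b}, c ≠ 0 → r (c * a) (c * b) → r a b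

/-! ### Subtraction-free divided differences. -/

section DividedDifference

variable {S : Type*} [CommSemiring S]

/-- The complete homogeneous polynomial `∑ s ^ i * t ^ j` over `i + j + 1 = n`. -/
def homogSum (s t : S) : ℕ → S
  | 0 => 0
  | n + 1 => s * homogSum s t n + t ^ n

theorem homogSum_add (s t : S) (i j : ℕ) :
    homogSum s t (i + j) = s ^ j * homogSum s t i + t ^ i * homogSum s t j := by
  induction j with
  | zero => simp [homogSum]
  | succ j ih =>
    rw [← add_assoc]
    simp only [homogSum, ih]
    ring

theorem pow_mul_homogSum_comm (s t : S) (i j : ℕ) :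
    s ^ i * homogSum s t j + homogSum s t i * t ^ j =
      t ^ i * homogSum s t j + homogSum s t i * s ^ j := by
  have h := homogSum_add s t i j
  rw [add_comm i j, homogSum_add s t j i] at h
  rw [mul_comm _ (t ^ j), h]
  ring

/-- The divided difference `(p(s) - p(t)) / (s - t)`, which makes sense over semirings. -/
noncomputable def divDiff (s t : S) (p : Polynomial S) : S :=
  p.sum fun i c => c * homogSum s t i

theorem divDiff_add (s t : S) (p q : Polynomial S) :
    divDiff s t (p + q) = divDiff s t p + divDiff s t q :=
  Polynomial.sum_add_index p q _ (by simp) (by intros; ring)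

theorem divDiff_monomial (s t : S) (n : ℕ) (c : S) :
    divDiff s t (Polynomial.monomial n c) = c * homogSum s t n :=
  Polynomial.sum_monomial_index c _ (by simp)

/-- Over a ring, both sides times `s - t` equal `p(s) q(s) - p(t) q(t)`: these are the two forms of
the Leibniz rule for divided differences. Bilinearity reduces to monomials, where splitting `i + j`
in either order gives the identity without subtraction. -/
theorem eval_mul_divDiff_comm (s t : S) (p q : Polynomial S) :
    p.eval s * divDiff s t q + divDiff s t p * q.eval t =
      p.eval t * divDiff s t q + divDiff s t p * q.eval s := by
  induction p using Polynomial.induction_on' with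
  | add p₁ p₂ h₁ h₂ =>
    simp only [Polynomial.eval_add, divDiff_add]
    calc _ = (p₁.eval s * divDiff s t q + divDiff s t p₁ * q.eval t) +
          (p₂.eval s * divDiff s t q + divDiff s t p₂ * q.eval t) := by ring
      _ = _ := by rw [h₁, h₂]; ring
  | monomial i c =>
    induction q using Polynomial.induction_on' with
    | add q₁ q₂ h₁ h₂ =>
      simp only [Polynomial.eval_add, divDiff_add]
      simp only [Polynomial.eval_monomial, divDiff_monomial] at h₁ h₂ ⊢
      calc _ = (c * s ^ i * divDiff s t q₁ + c * homogSum s t i * q₁.eval t) +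
            (c * s ^ i * divDiff s t q₂ + c * homogSum s t i * q₂.eval t) := by ring
        _ = _ := by rw [h₁, h₂]; ring
    | monomial j d =>
      simp only [Polynomial.eval_monomial, divDiff_monomial]
      calc _ = c * d * (s ^ i * homogSum s t j + homogSum s t i * t ^ j) := by ring
        _ = _ := by rw [pow_mul_homogSum_comm]; ring

theorem eval_add_divDiff_mul (s t : S) (p : Polynomial S) :
    p.eval s + divDiff s t p * t = p.eval t + divDiff s t p * s := by
  have h := eval_mul_divDiff_comm s t p Polynomial.X
  rw [← Polynomial.monomial_one_one_eq_X, divDiff_monomial] at h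
  simpa [homogSum] using h

end DividedDifference

/-! ### Extending cancellative preorders to total ones. -/

section Extension

variable {S : Type*} [CommSemiring S]

/-- The smallest cancellative preorder that extends `r` and satisfies `t ≤ s`. -/
def extendRel (r : S → S → Prop) (s t x y : S) : Prop :=
  ∃ p : Polynomial S, p.eval s ≠ 0 ∧ p.eval t ≠ 0 ∧ r (x * p.eval s) (y * p.eval t)

namespace IsCancelPreorder

variable {r : S → S → Prop}

theorem add_left (hr : IsCancelPreorder r) (c : S) {a b : S} (h : r a b) :
    r (c + a) (c + b) := by
  simpa only [add_comm c] using hr.add_right c h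

theorem mul_right (hr : IsCancelPreorder r) (c : S) {a b : S} (h : r a b) :
    r (a * c) (b * c) := by
  simpa only [mul_comm _ c] using hr.mul_left c h

theorem add (hr : IsCancelPreorder r) {a b c d : S} (h : r a b) (h' : r c d) :
    r (a + c) (b + d) :=
  hr.trans (hr.add_right c h) (hr.add_left b h')

theorem mul (hr : IsCancelPreorder r) {a b c d : S} (h : r a b) (h' : r c d) :
    r (a * c) (b * d) :=
  hr.trans (hr.mul_right c h) (hr.mul_left b h')

theorem pow (hr : IsCancelPreorder r) {a b : S} (h : r a b) (n : ℕ) : r (a ^ n) (b ^ n) := by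
  induction n with
  | zero => simpa using hr.refl 1
  | succ n ih => simpa only [pow_succ] using hr.mul ih h

theorem one_pow_le (hr : IsCancelPreorder r) {u : S} (h : r 1 u) (n : ℕ) : r 1 (u ^ n) := by
  simpa using hr.pow h n

theorem pow_mono (hr : IsCancelPreorder r) {u : S} (h : r 1 u) {m n : ℕ} (hmn : m ≤ n) :
    r (u ^ m) (u ^ n) := by
  obtain ⟨k, rfl⟩ := Nat.exists_eq_add_of_le hmn
  simpa [pow_add] using hr.mul_left (u ^ m) (hr.one_pow_le h k)

theorem sum (hr : IsCancelPreorder r) {ι : Type*} (A : Finset ι) (f g : ι → S)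
    (h : ∀ i ∈ A, r (f i) (g i)) : r (∑ i ∈ A, f i) (∑ i ∈ A, g i) := by
  classical
  induction A using Finset.induction_on with
  | empty => simpa using hr.refl 0
  | insert i A hi ih =>
    rw [Finset.sum_insert hi, Finset.sum_insert hi]
    exact hr.add (h i (Finset.mem_insert_self i A))
      (ih fun j hj => h j (Finset.mem_insert_of_mem hj))

theorem extend_of_rel [Nontrivial S] {s t x y : S} (h : r x y) : extendRel r s t x y :=
  ⟨1, by simp, by simp, by simpa using h⟩

theorem extend_rel (hr : IsCancelPreorder r) {s t : S} (hs : s ≠ 0) (ht : t ≠ 0) :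
    extendRel r s t t s :=
  ⟨Polynomial.X, by simpa, by simpa, by simpa [mul_comm] using hr.refl (t * s)⟩

variable [NoZeroDivisors S]

/-- Weight the inequality for `p` by the divided difference of `q`, that for `q` by the divided
difference of `p`, and add. By `eval_mul_divDiff_comm` the coefficients of `x` and `y` agree, so
they cancel. Zerosumfreeness makes the coefficient nonzero, unless the divided difference of `p`
vanishes, and then `p(s) = p(t)`. -/
theorem rel_of_extend_of_extend (hr : IsCancelPreorder r) (hS : IsZerosumfree S) {s t x y : S}
    (h₁ : extendRel r s t x y) (h₂ : extendRel r t s x y) : r x y := by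
  obtain ⟨p, hps, hpt, hp⟩ := h₁
  obtain ⟨q, hqt, hqs, hq⟩ := h₂
  by_cases h : divDiff s t p = 0
  · have := eval_add_divDiff_mul s t p
    simp only [h, zero_mul, add_zero] at this
    rw [this] at hp
    exact hr.cancel hpt (by simpa only [mul_comm _ (p.eval t)] using hp)
  set e := p.eval s * divDiff s t q + divDiff s t p * q.eval t with he
  have he0 : e ≠ 0 := fun h0 =>
    (mul_ne_zero h hqt) (hS _ _ h0).2
  refine hr.cancel he0 ?_
  have h3 := hr.add (hr.mul_right (divDiff s t q) hp) (hr.mul_right (divDiff s t p) hq)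
  convert h3 using 1
  · rw [he]; ring
  · rw [he, eval_mul_divDiff_comm]; ring

variable [Nontrivial S]

theorem extend (hr : IsCancelPreorder r) (hS : IsZerosumfree S) (s t : S) :
    IsCancelPreorder (extendRel r s t) where
  refl a := extend_of_rel (hr.refl a)
  trans := by
    rintro a b c ⟨p, hps, hpt, hp⟩ ⟨q, hqs, hqt, hq⟩
    refine ⟨p * q, by simp [hps, hqs], by simp [hpt, hqt], ?_⟩
    have h₁ := hr.mul_right (q.eval s) hp
    have h₂ := hr.mul_right (p.eval t) hq
    rw [Polynomial.eval_mul, Polynomial.eval_mul]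
    convert hr.trans h₁ (by convert h₂ using 1; ring) using 1 <;> ring
  add_right := by
    rintro c a b ⟨p, hps, hpt, hp⟩
    by_cases ha : a = 0 ∧ c = 0
    · obtain ⟨rfl, rfl⟩ := ha
      exact ⟨p, hps, hpt, by simpa using hp⟩
    have hac : a + c ≠ 0 := fun h => ha (hS a c h)
    -- This polynomial takes the value `(a + c) * p(t)` at `t`, so the claim is `a * p(s) + c * p(t)
    -- ≤ (b + c) * p(t)` multiplied by `a + c`. It needs `a + c ≠ 0`, hence the separate case above.
    refine ⟨Polynomial.C a * p + Polynomial.C (c * p.eval t), ?_, ?_, ?_⟩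
    · intro h
      simp only [Polynomial.eval_add, Polynomial.eval_mul, Polynomial.eval_C] at h
      obtain ⟨h₁, h₂⟩ := hS _ _ h
      exact ha ⟨(mul_eq_zero.1 h₁).resolve_right hps, (mul_eq_zero.1 h₂).resolve_right hpt⟩
    · simp only [Polynomial.eval_add, Polynomial.eval_mul, Polynomial.eval_C, ← add_mul]
      exact mul_ne_zero hac hpt
    · simp only [Polynomial.eval_add, Polynomial.eval_mul, Polynomial.eval_C]
      convert hr.mul_left (a + c) (hr.add_right (c * p.eval t) hp) using 1
      ring
  mul_left := by
    rintro c a b ⟨p, hps, hpt, hp⟩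
    exact ⟨p, hps, hpt, by simpa only [mul_assoc] using hr.mul_left c hp⟩
  cancel := by
    rintro c a b hc ⟨p, hps, hpt, hp⟩
    exact ⟨p, hps, hpt, hr.cancel hc (by simpa only [mul_assoc] using hp)⟩

/-- A cancellative preorder in which `u * x ^ n ≤ y ^ n` fails for all `n ≥ 1` has an extension that
is total on nonzero elements and has the same property. -/
theorem exists_total_extension (hr : IsCancelPreorder r) (hS : IsZerosumfree S) {u x y : S}
    (hu : r 1 u) (h : ∀ n : ℕ, 0 < n → ¬ r (u * x ^ n) (y ^ n)) :
    ∃ r' : S → S → Prop, IsCancelPreorder r' ∧ (∀ a b, r a b → r' a b) ∧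
      (∀ a b, a ≠ 0 → b ≠ 0 → r' a b ∨ r' b a) ∧
      ∀ n : ℕ, 0 < n → ¬ r' (u * x ^ n) (y ^ n) := by
  obtain ⟨m, hrm, hm⟩ := zorn_le_nonempty₀
    {r' : S → S → Prop | IsCancelPreorder r' ∧ r ≤ r' ∧
      ∀ n : ℕ, 0 < n → ¬ r' (u * x ^ n) (y ^ n)} (by
    rintro C hC hchain r₀ hr₀
    refine ⟨fun a b => ∃ r' ∈ C, r' a b, ⟨?_, ?_, ?_⟩, fun r' hr' a b hab => ⟨r', hr', hab⟩⟩
    · refine ⟨fun a => ⟨r₀, hr₀, (hC hr₀).1.refl a⟩, ?_, ?_, ?_, ?_⟩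
      · rintro a b c ⟨r₁, h₁, hab⟩ ⟨r₂, h₂, hbc⟩
        rcases hchain.total h₁ h₂ with hle | hle
        · exact ⟨r₂, h₂, (hC h₂).1.trans (hle a b hab) hbc⟩
        · exact ⟨r₁, h₁, (hC h₁).1.trans hab (hle b c hbc)⟩
      · rintro c a b ⟨r₁, h₁, hab⟩
        exact ⟨r₁, h₁, (hC h₁).1.add_right c hab⟩
      · rintro c a b ⟨r₁, h₁, hab⟩
        exact ⟨r₁, h₁, (hC h₁).1.mul_left c hab⟩
      · rintro c a b hc ⟨r₁, h₁, hab⟩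
        exact ⟨r₁, h₁, (hC h₁).1.cancel hc hab⟩
    · exact fun a b hab => ⟨r₀, hr₀, (hC hr₀).2.1 a b hab⟩
    · rintro n hn ⟨r₁, h₁, hab⟩
      exact (hC h₁).2.2 n hn hab) r ⟨hr, le_rfl, h⟩
  obtain ⟨hmc, -, hmn⟩ := hm.prop
  refine ⟨m, hmc, hrm, fun a b ha hb => ?_, hmn⟩
  -- By maximality, adjoining a missing `t ≤ s` must break the defining property.
  have key : ∀ s t : S, s ≠ 0 → t ≠ 0 → ¬ m t s →
      ∃ n : ℕ, 0 < n ∧ extendRel m s t (u * x ^ n) (y ^ n) := by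
    intro s t hs ht hts
    by_contra! hcon
    exact hts (hm.le_of_ge (y := extendRel m s t) ⟨hmc.extend hS s t,
      fun a b hab => extend_of_rel (hrm a b hab), hcon⟩ (fun a b hab => extend_of_rel hab) t s
      (hmc.extend_rel hs ht))
  -- The two extensions break it at different exponents; powers bring both to `i * j`, and the
  -- surplus `u ^ j` is weakened to `u` since `j ≥ 1`.
  have raise : ∀ (r' : S → S → Prop) (i j : ℕ), IsCancelPreorder r' → r' 1 u → 0 < j →
      r' (u * x ^ i) (y ^ i) → r' (u * x ^ (i * j)) (y ^ (i * j)) := by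
    intro r' i j hr' hu' hj hi
    have h1 := hr'.pow hi j
    rw [mul_pow, ← pow_mul, ← pow_mul] at h1
    refine hr'.trans (hr'.mul_right _ ?_) h1
    simpa using hr'.pow_mono hu' (Nat.succ_le_of_lt hj)
  by_contra! hab
  obtain ⟨i, hi, h₁⟩ := key b a hb ha hab.1
  obtain ⟨j, hj, h₂⟩ := key a b ha hb hab.2
  have hu' := hrm 1 u hu
  refine hmn (i * j) (Nat.mul_pos hi hj) (hmc.rel_of_extend_of_extend hS (s := b) (t := a) ?_ ?_)
  · exact raise _ i j (hmc.extend hS b a) (extend_of_rel hu') hj h₁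
  · rw [mul_comm i j]
    exact raise _ j i (hmc.extend hS a b) (extend_of_rel hu') hi h₂

end IsCancelPreorder

end Extension

/-- Turns estimates with an error independent of `n` into exact inequalities between logarithms. -/
theorem nonpos_of_forall_nat_mul_le {x C : ℝ} (h : ∀ n : ℕ, 0 < n → n * x ≤ C) : x ≤ 0 := by
  by_contra! hx
  obtain ⟨n, hn⟩ := exists_nat_gt (C / x)
  rw [div_lt_iff₀ hx] at hn
  have := h (n + 1) n.succ_pos
  push_cast at this
  linarith

/-- The exponential function with values in the nonnegative reals. -/
noncomputable def nnexp (x : ℝ) : ℝ≥0 := (Real.exp x).toNNReal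

@[simp]
theorem coe_nnexp (x : ℝ) : (nnexp x : ℝ) = Real.exp x :=
  Real.coe_toNNReal _ (Real.exp_pos x).le

/-! ### From logarithms to real or tropical homomorphisms. -/

section LogHom

variable {S : Type*} [CommSemiring S]

/-- A logarithmic form of a homomorphism, defined on nonzero elements, from the multiplicative
monoid of `S` to the positive reals whose induced preorder is compatible with addition. -/
structure IsLogHom (l : S → ℝ) : Prop where
  map_mul : ∀ {a b}, a ≠ 0 → b ≠ 0 → l (a * b) = l a + l b
  add_mono : ∀ {a b c}, a ≠ 0 → b ≠ 0 → c ≠ 0 → l a ≤ l b → l (a + c) ≤ l (b + c)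

namespace IsLogHom

variable {l : S → ℝ}

theorem neg (hl : IsLogHom l) : IsLogHom (fun a => - l a) where
  map_mul ha hb := by rw [hl.map_mul ha hb]; ring
  add_mono ha hb hc h := neg_le_neg (hl.add_mono hb ha hc (neg_le_neg_iff.1 h))

theorem map_one [Nontrivial S] (hl : IsLogHom l) : l 1 = 0 := by
  have := hl.map_mul (one_ne_zero (α := S)) one_ne_zero
  rw [mul_one] at this
  linarith

theorem add_le_add (hl : IsLogHom l) {a b c d : S} (ha : a ≠ 0) (hb : b ≠ 0) (hc : c ≠ 0)
    (hd : d ≠ 0) (h : l a ≤ l b) (h' : l c ≤ l d) : l (a + c) ≤ l (b + d) := by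
  refine (hl.add_mono ha hb hc h).trans ?_
  rw [add_comm b c, add_comm b d]
  exact hl.add_mono hc hd hb h'

theorem add_ne_zero (hS : IsZerosumfree S) {a : S} (b : S) (ha : a ≠ 0) : a + b ≠ 0 :=
  fun h => ha (hS a b h).1

theorem natCast_ne_zero [Nontrivial S] (hS : IsZerosumfree S) {n : ℕ} (hn : 0 < n) :
    (n : S) ≠ 0 := by
  obtain ⟨m, rfl⟩ := Nat.exists_eq_succ_of_ne_zero hn.ne'
  intro h
  rw [Nat.cast_succ] at h
  exact one_ne_zero (hS _ _ h).2

theorem two_ne_zero [Nontrivial S] (hS : IsZerosumfree S) : (2 : S) ≠ 0 := by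
  exact_mod_cast natCast_ne_zero hS two_pos

theorem map_add_self [Nontrivial S] (hl : IsLogHom l) (hS : IsZerosumfree S) {a : S}
    (ha : a ≠ 0) : l (a + a) = l 2 + l a := by
  rw [← two_mul, hl.map_mul (two_ne_zero hS) ha]

theorem natCast_le_succ [Nontrivial S] (hl : IsLogHom l) (hS : IsZerosumfree S) (h2 : 0 ≤ l 2)
    {n : ℕ} (hn : 0 < n) : l (n : S) ≤ l ((n + 1 : ℕ) : S) := by
  induction n, (hn : 1 ≤ n) using Nat.le_induction with
  | base => simpa [hl.map_one, one_add_one_eq_two] using h2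
  | succ k hk ih =>
    rw [Nat.cast_succ k, Nat.cast_succ (k + 1)]
    exact hl.add_mono (natCast_ne_zero hS hk) (natCast_ne_zero hS k.succ_pos) one_ne_zero ih

theorem natCast_mono [Nontrivial S] (hl : IsLogHom l) (hS : IsZerosumfree S) (h2 : 0 ≤ l 2)
    {m n : ℕ} (hm : 0 < m) (hmn : m ≤ n) : l (m : S) ≤ l (n : S) := by
  induction n, hmn using Nat.le_induction with
  | base => exact le_rfl
  | succ n hmn ih => exact ih.trans (hl.natCast_le_succ hS h2 (hm.trans_le hmn))

theorem map_add_of_two_eq_zero [Nontrivial S] (hl : IsLogHom l) (hS : IsZerosumfree S) (h2 : l 2 = 0) {a b : S}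
    (ha : a ≠ 0) (hb : b ≠ 0) : min (l a) (l b) ≤ l (a + b) ∧ l (a + b) ≤ max (l a) (l b) := by
  have hself : ∀ {a : S}, a ≠ 0 → l (a + a) = l a := fun ha => by
    rw [hl.map_add_self hS ha, h2, zero_add]
  rcases le_total (l a) (l b) with h | h
  · rw [min_eq_left h, max_eq_right h, ← hself ha, ← hself hb]
    exact ⟨hl.add_le_add ha ha ha hb le_rfl (by simpa only [hself ha]),
      by simpa only [hself hb] using hl.add_le_add ha hb hb hb h le_rfl⟩
  · rw [min_eq_right h, max_eq_left h]
    exact ⟨(hself hb).ge.trans (hl.add_le_add hb ha hb hb h le_rfl),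
      (hl.add_le_add ha ha hb ha le_rfl h).trans (hself ha).le⟩

variable [NoZeroDivisors S] [Nontrivial S]

theorem map_pow (hl : IsLogHom l) {a : S} (ha : a ≠ 0) (n : ℕ) : l (a ^ n) = n * l a := by
  induction n with
  | zero => simp [hl.map_one]
  | succ n ih =>
    rw [pow_succ, hl.map_mul (pow_ne_zero n ha) ha, ih]
    push_cast
    ring

/-- A monotone completely additive function on positive integers is a multiple of `log`: squeeze `n
^ k` between consecutive powers of `2` and let `k` grow. -/
theorem map_natCast_mul_log_two (hl : IsLogHom l) (hS : IsZerosumfree S) (h2 : 0 < l 2) {n : ℕ}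
    (hn : 0 < n) : l (n : S) * Real.log 2 = l 2 * Real.log n := by
  have hlog : 0 < Real.log 2 := Real.log_pos one_lt_two
  have bounds : ∀ k : ℕ, ∃ j : ℕ, j * l 2 ≤ k * l (n : S) ∧ k * l (n : S) ≤ (j + 1) * l 2 ∧
      j * Real.log 2 ≤ k * Real.log n ∧ k * Real.log n ≤ (j + 1) * Real.log 2 := by
    intro k
    have hnk : 0 < n ^ k := pow_pos hn k
    have h₁ : 2 ^ Nat.log 2 (n ^ k) ≤ n ^ k := Nat.pow_log_le_self 2 hnk.ne'
    have h₂ : n ^ k ≤ 2 ^ (Nat.log 2 (n ^ k) + 1) := (Nat.lt_pow_succ_log_self one_lt_two _).le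
    refine ⟨Nat.log 2 (n ^ k), ?_, ?_, ?_, ?_⟩
    · have := hl.natCast_mono hS h2.le (by positivity) h₁
      simpa [hl.map_pow (natCast_ne_zero hS hn), hl.map_pow (two_ne_zero hS)] using this
    · have := hl.natCast_mono hS h2.le hnk h₂
      simpa [hl.map_pow (natCast_ne_zero hS hn), hl.map_pow (two_ne_zero hS)] using this
    · rw [← Real.log_pow, ← Real.log_pow]
      exact Real.log_le_log (by positivity) (by exact_mod_cast h₁)
    · have h₃ : (n : ℝ) ^ k ≤ 2 ^ (Nat.log 2 (n ^ k) + 1) := by exact_mod_cast h₂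
      have := Real.log_le_log (by positivity) h₃
      rw [Real.log_pow, Real.log_pow] at this
      exact_mod_cast this
  apply le_antisymm
  · refine sub_nonpos.1 (nonpos_of_forall_nat_mul_le (C := l 2 * Real.log 2) fun k _ => ?_)
    obtain ⟨j, -, h₂, h₃, -⟩ := bounds k
    have := mul_le_mul_of_nonneg_right h₂ hlog.le
    have := mul_le_mul_of_nonneg_right h₃ h2.le
    linarith
  · refine sub_nonpos.1 (nonpos_of_forall_nat_mul_le (C := l 2 * Real.log 2) fun k _ => ?_)
    obtain ⟨j, h₁, -, -, h₄⟩ := bounds k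
    have := mul_le_mul_of_nonneg_right h₁ hlog.le
    have := mul_le_mul_of_nonneg_right h₄ h2.le
    linarith

/-- The normalization makes `M (n * a) = n * M a`. Comparing `m * a` with `n * b` and adding `m * b`
compares `m * (a + b)` with `(n + m) * b`, so rational approximations of `M a / M b` determine `M (a
+ b)`. -/
theorem exp_map_add (hl : IsLogHom l) (hS : IsZerosumfree S) (h2 : 0 < l 2) {a b : S}
    (ha : a ≠ 0) (hb : b ≠ 0) :
    Real.exp (Real.log 2 / l 2 * l (a + b)) =
      Real.exp (Real.log 2 / l 2 * l a) + Real.exp (Real.log 2 / l 2 * l b) := by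
  have hc : 0 < Real.log 2 / l 2 := div_pos (Real.log_pos one_lt_two) h2
  set M : S → ℝ := fun a => Real.exp (Real.log 2 / l 2 * l a) with hM
  have hMle : ∀ {a b}, M a ≤ M b ↔ l a ≤ l b := fun {a b} => by
    simp only [hM, Real.exp_le_exp]
    exact mul_le_mul_iff_right₀ hc
  have hMpos : ∀ a, 0 < M a := fun a => Real.exp_pos _
  have hMn : ∀ {n : ℕ} {a : S}, 0 < n → a ≠ 0 → M (n * a) = n * M a := by
    intro n a hn ha
    have h := hl.map_natCast_mul_log_two hS h2 hn
    simp only [hM]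
    rw [hl.map_mul (natCast_ne_zero hS hn) ha, mul_add, Real.exp_add]
    congr 1
    rw [show Real.log 2 / l 2 * l (n : S) = Real.log n by field_simp; linarith]
    exact Real.exp_log (by exact_mod_cast hn)
  have hab : a + b ≠ 0 := add_ne_zero hS b ha
  have hnat : ∀ {n : ℕ} {a : S}, 0 < n → a ≠ 0 → (n : S) * a ≠ 0 := fun hn ha =>
    mul_ne_zero (natCast_ne_zero hS hn) ha
  have upper : ∀ {m n : ℕ}, 0 < m → 0 < n → m * M a ≤ n * M b →
      m * M (a + b) ≤ (n + m) * M b := by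
    intro m n hm hn h
    rw [← hMn hm ha, ← hMn hn hb, hMle] at h
    have h' := hl.add_mono (hnat hm ha) (hnat hn hb) (hnat hm hb) h
    rw [← mul_add, ← add_mul, ← Nat.cast_add, ← hMle, hMn hm hab,
      hMn (Nat.add_pos_left hn m) hb] at h'
    exact_mod_cast h'
  have lower : ∀ {m n : ℕ}, 0 < m → 0 < n → n * M b ≤ m * M a →
      (n + m) * M b ≤ m * M (a + b) := by
    intro m n hm hn h
    rw [← hMn hm ha, ← hMn hn hb, hMle] at h
    have h' := hl.add_mono (hnat hn hb) (hnat hm ha) (hnat hm hb) h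
    rw [← mul_add, ← add_mul, ← Nat.cast_add, ← hMle, hMn hm hab,
      hMn (Nat.add_pos_left hn m) hb] at h'
    exact_mod_cast h'
  have between : ∀ {s t : ℝ}, 0 ≤ s → s < t → ∃ m n : ℕ, 0 < m ∧ 0 < n ∧ s * m < n ∧ n < t * m := by
    intro s t hs hst
    obtain ⟨q, hsq, hqt⟩ := exists_rat_btwn hst
    have hq : 0 < q := by exact_mod_cast hs.trans_lt hsq
    have hnum : 0 < q.num := Rat.num_pos.2 hq
    have hden : (0 : ℝ) < q.den := by exact_mod_cast q.den_pos
    have hqe : (q : ℝ) = (q.num.toNat : ℝ) / q.den := by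
      rw [Rat.cast_def]
      congr 1
      exact_mod_cast (Int.toNat_of_nonneg hnum.le).symm
    rw [hqe] at hsq hqt
    exact ⟨q.den, q.num.toNat, q.den_pos, by omega, (lt_div_iff₀ hden).1 hsq,
      (div_lt_iff₀ hden).1 hqt⟩
  change M (a + b) = M a + M b
  have hb' := hMpos b
  apply le_antisymm
  · by_contra! h
    have hlt : M a / M b < (M (a + b) - M b) / M b := by gcongr; linarith
    obtain ⟨m, n, hm, hn, h₁, h₂⟩ := between (div_pos (hMpos a) hb').le hlt
    rw [div_mul_eq_mul_div, div_lt_iff₀ hb'] at h₁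
    rw [div_mul_eq_mul_div, lt_div_iff₀ hb'] at h₂
    have := upper hm hn (by linarith)
    linarith
  · by_contra! h
    -- `M (a + b) - M b` may a priori be negative, whereas the rational must be positive.
    have hlt : max 0 ((M (a + b) - M b) / M b) < M a / M b :=
      max_lt (div_pos (hMpos a) hb') (by gcongr; linarith)
    obtain ⟨m, n, hm, hn, h₁, h₂⟩ := between (le_max_left _ _) hlt
    rw [div_mul_eq_mul_div, lt_div_iff₀ hb'] at h₂
    have h₃ : (M (a + b) - M b) / M b * m < n :=
      (mul_le_mul_of_nonneg_right (le_max_right _ _) m.cast_nonneg).trans_lt h₁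
    rw [div_mul_eq_mul_div, div_lt_iff₀ hb'] at h₃
    have := lower hm hn (by linarith)
    linarith

/-- If `2` is larger than `1`, the preorder is induced by a homomorphism to the nonnegative
reals. -/
theorem exists_nnrealHom (hl : IsLogHom l) (hS : IsZerosumfree S) (h2 : 0 < l 2) :
    ∃ c : ℝ, 0 < c ∧ ∃ φ : S →+* ℝ≥0, ∀ a, a ≠ 0 → (φ a : ℝ) = Real.exp (c * l a) := by
  classical
  refine ⟨Real.log 2 / l 2, div_pos (Real.log_pos one_lt_two) h2,
    { toFun := fun a => if a = 0 then 0 else nnexp (Real.log 2 / l 2 * l a)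
      map_zero' := if_pos rfl
      map_one' := ?_
      map_mul' := ?_
      map_add' := ?_ }, ?_⟩
  · rw [if_neg one_ne_zero]
    ext
    simp [hl.map_one]
  · intro a b
    by_cases ha : a = 0
    · simp [ha]
    by_cases hb : b = 0
    · simp [hb]
    rw [if_neg ha, if_neg hb, if_neg (mul_ne_zero ha hb)]
    ext
    simp [hl.map_mul ha hb, mul_add, Real.exp_add]
  · intro a b
    by_cases ha : a = 0
    · simp [ha]
    by_cases hb : b = 0
    · simp [hb]
    simp only [if_neg ha, if_neg hb, if_neg (add_ne_zero hS b ha)]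
    ext
    simpa using hl.exp_map_add hS h2 ha hb
  · intro a ha
    simp [ha]

theorem exists_tropRealHom (hl : IsLogHom l) (hS : IsZerosumfree S)
    (hmax : ∀ a b, a ≠ 0 → b ≠ 0 → l (a + b) = max (l a) (l b)) :
    ∃ φ : S →+* TropReal, ∀ a, a ≠ 0 → ((φ a).val : ℝ) = Real.exp (l a) := by
  classical
  refine ⟨
    { toFun := fun a => ⟨if a = 0 then 0 else nnexp (l a)⟩
      map_zero' := by simp; rfl
      map_one' := ?_
      map_mul' := ?_
      map_add' := ?_ }, ?_⟩
  · ext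
    simp [hl.map_one]
  · intro a b
    by_cases ha : a = 0
    · ext; simp [ha]
    by_cases hb : b = 0
    · ext; simp [hb]
    ext
    simp [ha, hb, hl.map_mul ha hb, Real.exp_add]
  · intro a b
    by_cases ha : a = 0
    · ext; simp [ha]
    by_cases hb : b = 0
    · ext; simp [hb]
    ext
    simp [ha, hb, add_ne_zero hS b ha, hmax a b ha hb, Real.exp_monotone.map_max]
  · intro a ha
    simp [ha]

/-- If `2` is equivalent to `1`, addition is either always the maximum or always the minimum. -/
theorem max_or_min (hl : IsLogHom l) (hS : IsZerosumfree S) (h2 : l 2 = 0) :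
    (∀ a b, a ≠ 0 → b ≠ 0 → l (a + b) = max (l a) (l b)) ∨
      ∀ a b, a ≠ 0 → b ≠ 0 → l (a + b) = min (l a) (l b) := by
  have hself : ∀ {a : S}, a ≠ 0 → l (a + a) = l a := fun ha => by
    rw [hl.map_add_self hS ha, h2, zero_add]
  have absorb : ∀ {a b : S}, a ≠ 0 → b ≠ 0 → l ((a + b) + b) = l (a + b) := fun {a b} ha hb => by
    rw [add_assoc, add_comm a, add_comm a]
    exact le_antisymm (hl.add_mono (add_ne_zero hS b hb) hb ha (hself hb).le)
      (hl.add_mono hb (add_ne_zero hS b hb) ha (hself hb).ge)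
  by_contra! hcon
  obtain ⟨⟨a, b, ha, hb, hab⟩, ⟨c, d, hc, hd, hcd⟩⟩ := hcon
  have hlt := lt_of_le_of_ne (hl.map_add_of_two_eq_zero hS h2 ha hb).2 hab
  have hgt := lt_of_le_of_ne (hl.map_add_of_two_eq_zero hS h2 hc hd).1 hcd.symm
  -- Since `a + b` absorbs both summands, failure of max gives an `e` absorbing a larger `b`;
  -- failure of min gives an `f` absorbing a smaller `c`.
  obtain ⟨e, b, he, hb, heb, hlt⟩ : ∃ e b : S, e ≠ 0 ∧ b ≠ 0 ∧ l (e + b) = l e ∧ l e < l b := by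
    rcases lt_max_iff.1 hlt with h | h
    · exact ⟨a + b, a, add_ne_zero hS b ha, ha, by rw [add_comm a b]; exact absorb hb ha, h⟩
    · exact ⟨a + b, b, add_ne_zero hS b ha, hb, absorb ha hb, h⟩
  obtain ⟨f, c, hf, hc, hfc, hgt⟩ : ∃ f c : S, f ≠ 0 ∧ c ≠ 0 ∧ l (f + c) = l f ∧ l c < l f := by
    rcases min_lt_iff.1 hgt with h | h
    · exact ⟨c + d, c, add_ne_zero hS d hc, hc, by rw [add_comm c d]; exact absorb hd hc, h⟩
    · exact ⟨c + d, d, add_ne_zero hS d hc, hd, absorb hc hd, h⟩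
  have hpow : ∀ n : ℕ, l (e ^ n + b ^ n) ≤ l (e ^ n) := by
    intro n
    have hen := pow_ne_zero n he
    have hbn := pow_ne_zero n hb
    induction n with
    | zero => simp [hl.map_one, one_add_one_eq_two, h2]
    | succ n ih =>
      have hen' := pow_ne_zero n he
      have hbn' := pow_ne_zero n hb
      have h₁ : l (e ^ n * (e + b)) = l (e ^ (n + 1)) := by
        rw [hl.map_mul hen' (add_ne_zero hS b he), heb, ← hl.map_mul hen' he, pow_succ]
      have h₂ : l (b * (e ^ n + b ^ n)) ≤ l (b * e ^ n) := by
        rw [hl.map_mul hb (add_ne_zero hS _ hen'), hl.map_mul hb hen']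
        linarith [ih hen' hbn']
      calc l (e ^ (n + 1) + b ^ (n + 1)) ≤ l (e ^ n * (e + b) + b ^ (n + 1)) :=
            hl.add_mono hen (mul_ne_zero hen' (add_ne_zero hS b he)) hbn h₁.ge
        _ = l (b * (e ^ n + b ^ n) + e ^ (n + 1)) := by congr 1; ring
        _ ≤ l (b * e ^ n + e ^ (n + 1)) :=
            hl.add_mono (mul_ne_zero hb (add_ne_zero hS _ hen')) (mul_ne_zero hb hen') hen h₂
        _ = l (e ^ n * (e + b)) := by congr 1; ring
        _ = _ := h₁
  -- For such `n`, `e ^ n * f` lies below `b ^ n * c`. Adding `e ^ n * c` puts `e ^ n * (f + c)`,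
  -- equivalent to `e ^ n * f`, below `(e ^ n + b ^ n) * c`, hence below `e ^ n * c` by `hpow`: this
  -- contradicts `l c < l f`.
  obtain ⟨n, hn⟩ := exists_nat_gt ((l f - l c) / (l b - l e))
  rw [div_lt_iff₀ (sub_pos.2 hlt)] at hn
  have hen := pow_ne_zero n he
  have hbn := pow_ne_zero n hb
  have hmul := fun {a b : S} => hl.map_mul (a := a) (b := b)
  have h₁ : l (e ^ n * f) ≤ l (b ^ n * c) := by
    rw [hmul hen hf, hmul hbn hc, hl.map_pow he, hl.map_pow hb]
    linarith
  have h₂ := hl.add_mono (mul_ne_zero hen hf) (mul_ne_zero hbn hc) (mul_ne_zero hen hc) h₁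
  rw [← mul_add, ← add_mul, hmul hen (add_ne_zero hS c hf), hfc, add_comm (b ^ n),
    hmul (add_ne_zero hS _ hen) hc] at h₂
  linarith [hpow n]

end IsLogHom

end LogHom

/-- A homomorphism regarded as taking values in the order dual. -/
def RingHom.toOrderDual {S T : Type*} [CommSemiring S] [CommSemiring T] (φ : S →+* T) :
    S →+* Tᵒᵈ where
  toFun a := OrderDual.toDual (φ a)
  map_zero' := φ.map_zero
  map_one' := φ.map_one
  map_add' := φ.map_add
  map_mul' := φ.map_mul

/-- Logarithms only control nonzero elements, so comparisons with `0` are treated separately. -/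
theorem isSpectralHom_of_ne_zero {S T : Type*} [CommSemiring S] [Preorder S] [CommSemiring T]
    [Preorder T] {φ : S →+* T} (hne : ∀ a, a ≠ 0 → φ a ≠ 0)
    (hmono : ∀ a b, a ≠ 0 → b ≠ 0 → a ≤ b → φ a ≤ φ b) (hnonneg : ∀ b, b ≠ 0 → 0 ≤ b → 0 ≤ φ b)
    (hnonpos : ∀ b, b ≠ 0 → b ≤ 0 → φ b ≤ 0) : IsSpectralHom φ where
  monotone a b h := by
    by_cases ha : a = 0
    · by_cases hb : b = 0
      · rw [ha, hb]
      · subst ha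
        simpa using hnonneg b hb h
    · by_cases hb : b = 0
      · subst hb
        simpa using hnonpos a ha h
      · exact hmono a b ha hb h
  eq_zero_of_map_eq_zero a h := by
    by_contra ha
    exact hne a ha h

/-! ### Constructing the logarithm and separating by spectral homomorphisms. -/

section Spectral

variable {S : Type*} [CommSemiring S] [NoZeroDivisors S]

namespace IsCancelPreorder

variable {r : S → S → Prop}

theorem pow_le_pow_iff (hr : IsCancelPreorder r) {u : S} (hu0 : u ≠ 0) (hu : r 1 u)
    (hu' : ¬ r u 1) {m n : ℕ} : r (u ^ m) (u ^ n) ↔ m ≤ n := by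
  refine ⟨fun h => ?_, hr.pow_mono hu⟩
  by_contra! hlt
  refine hu' (hr.cancel (pow_ne_zero n hu0) ?_)
  simpa [pow_succ] using hr.trans (hr.pow_mono hu (Nat.succ_le_of_lt hlt)) h

/-- A cancellative preorder with a strict order unit `u` has a log-homomorphism normalized at
`u`, namely the supremum of all rationals `(b - a) / q` such that `u ^ b ≤ z ^ q * u ^ a`. -/
theorem exists_log (hr : IsCancelPreorder r) {u : S} (hu0 : u ≠ 0) (hu : r 1 u) (hu' : ¬ r u 1)
    (hbdd : ∀ z, z ≠ 0 → ∃ k : ℕ, r z (u ^ k) ∧ r 1 (u ^ k * z)) :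
    ∃ l : S → ℝ, ∀ z, z ≠ 0 → ∀ q a b : ℕ, 0 < q →
      (r (z ^ q * u ^ a) (u ^ b) → q * l z ≤ b - a) ∧
      (r (u ^ b) (z ^ q * u ^ a) → b - a ≤ q * l z) := by
  refine ⟨fun z => sSup {t : ℝ | ∃ q a b : ℕ, 0 < q ∧ r (u ^ b) (z ^ q * u ^ a) ∧
    t = (b - a) / q}, fun z hz q a b hq => ?_⟩
  have hq' : (0 : ℝ) < q := by exact_mod_cast hq
  -- Raising to the powers `q'` and `q` eliminates `z`: lower estimates never exceed upper ones.
  have bound : ∀ {q a b q' a' b' : ℕ}, 0 < q → 0 < q' → r (z ^ q * u ^ a) (u ^ b) →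
      r (u ^ b') (z ^ q' * u ^ a') → ((b' : ℝ) - a') / q' ≤ (b - a) / q := by
    intro q a b q' a' b' hq hq' h h'
    have h₁ := hr.mul_right (u ^ (a' * q)) (hr.pow h q')
    have h₂ := hr.mul_right (u ^ (a * q')) (hr.pow h' q)
    have h₃ : r (u ^ (b' * q + a * q')) (u ^ (b * q' + a' * q)) := by
      convert hr.trans h₂ (by convert h₁ using 1; ring) using 1 <;> ring
    have h₄ := (hr.pow_le_pow_iff hu0 hu hu').1 h₃
    have h₅ : (b' : ℝ) * q + a * q' ≤ b * q' + a' * q := by exact_mod_cast h₄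
    rw [div_le_div_iff₀ (by exact_mod_cast hq') (by exact_mod_cast hq)]
    linarith
  obtain ⟨k, hk, hk'⟩ := hbdd z hz
  constructor
  · intro h
    rw [← le_div_iff₀' hq']
    refine csSup_le ⟨_, 1, k, 0, one_pos, by simpa [mul_comm] using hk', rfl⟩ ?_
    rintro t ⟨q', a', b', hq', h', rfl⟩
    exact bound hq hq' h h'
  · intro h
    rw [← div_le_iff₀' hq']
    refine le_csSup ⟨((k : ℕ) - (0 : ℕ)) / (1 : ℕ), ?_⟩ ⟨q, a, b, hq, h, rfl⟩
    rintro t ⟨q', a', b', hq', h', rfl⟩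
    exact bound one_pos hq' (by simpa using hk) h'

/-- A total cancellative preorder with a strict order unit `u` can be coarsened to one that is
induced by a log-homomorphism. -/
theorem exists_isLogHom [Nontrivial S] (hr : IsCancelPreorder r) (hS : IsZerosumfree S) {u : S} (hu0 : u ≠ 0)
    (hu : r 1 u) (hu' : ¬ r u 1) (htot : ∀ a b, a ≠ 0 → b ≠ 0 → r a b ∨ r b a)
    (hbdd : ∀ z, z ≠ 0 → ∃ k : ℕ, r z (u ^ k) ∧ r 1 (u ^ k * z)) :
    ∃ l : S → ℝ, IsLogHom l ∧ l u = 1 ∧ ∀ a b, a ≠ 0 → b ≠ 0 → r a b → l a ≤ l b := by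
  obtain ⟨l, hl⟩ := hr.exists_log hu0 hu hu' hbdd
  -- By totality, `z ^ q` lies within one factor `u` of an integral power of `u`. The shift `u ^ a`
  -- lifts it above `1`, so that exponents stay natural.
  have approx : ∀ z, z ≠ 0 → ∀ q : ℕ, ∃ a b : ℕ, r (u ^ b) (z ^ q * u ^ a) ∧
      r (z ^ q * u ^ a) (u ^ (b + 1)) := by
    classical
    intro z hz q
    obtain ⟨a, hza, haz⟩ := hbdd (z ^ q) (pow_ne_zero q hz)
    have hex : ∃ b, r (z ^ q * u ^ a) (u ^ b) :=
      ⟨a + a, by simpa only [pow_add] using hr.mul_right (u ^ a) hza⟩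
    have hfind := Nat.find_spec hex
    rcases hb : Nat.find hex with _ | b
    · rw [hb] at hfind
      exact ⟨a, 0, by simpa [mul_comm] using haz, hr.trans hfind (hr.pow_mono hu (Nat.zero_le _))⟩
    · rw [hb] at hfind
      refine ⟨a, b, ?_, hfind⟩
      exact (htot _ _ (pow_ne_zero b hu0) (mul_ne_zero (pow_ne_zero q hz) (pow_ne_zero a hu0))
        ).resolve_right (Nat.find_min hex (by omega))
  have hmul : ∀ {z w : S}, z ≠ 0 → w ≠ 0 → l (z * w) = l z + l w := by
    intro z w hz hw
    have key : ∀ q : ℕ, 0 < q → |q * (l (z * w) - (l z + l w))| ≤ 2 := by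
      intro q hq
      obtain ⟨a, b, h₁, h₂⟩ := approx z hz q
      obtain ⟨a', b', h₁', h₂'⟩ := approx w hw q
      have h₃ : r (u ^ (b + b')) ((z * w) ^ q * u ^ (a + a')) := by
        convert hr.mul h₁ h₁' using 1 <;> ring
      have h₄ : r ((z * w) ^ q * u ^ (a + a')) (u ^ (b + b' + 2)) := by
        convert hr.mul h₂ h₂' using 1 <;> ring
      have e₁ := (hl z hz q a b hq).2 h₁
      have e₂ := (hl z hz q a (b + 1) hq).1 h₂
      have e₁' := (hl w hw q a' b' hq).2 h₁'
      have e₂' := (hl w hw q a' (b' + 1) hq).1 h₂'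
      have e₃ := (hl _ (mul_ne_zero hz hw) q _ _ hq).2 h₃
      have e₄ := (hl _ (mul_ne_zero hz hw) q _ _ hq).1 h₄
      push_cast at e₁ e₂ e₁' e₂' e₃ e₄
      rw [abs_le]
      constructor <;> linarith
    apply le_antisymm
    · exact sub_nonpos.1 (nonpos_of_forall_nat_mul_le fun q hq => (abs_le.1 (key q hq)).2)
    · refine sub_nonpos.1 (nonpos_of_forall_nat_mul_le (C := 2) fun q hq => ?_)
      have := (abs_le.1 (key q hq)).1
      linarith
  have hmono : ∀ a b, a ≠ 0 → b ≠ 0 → r a b → l a ≤ l b := by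
    intro z w hz hw h
    refine sub_nonpos.1 (nonpos_of_forall_nat_mul_le (C := 1) fun q hq => ?_)
    obtain ⟨a, b, h₁, h₂⟩ := approx w hw q
    have e₁ := (hl w hw q a b hq).2 h₁
    have e₂ := (hl z hz q a (b + 1) hq).1 (hr.trans (hr.mul_right _ (hr.pow h q)) h₂)
    push_cast at e₂
    linarith
  have hlu : l u = 1 := by
    have h₁ := (hl u hu0 1 0 1 one_pos).1 (by simpa using hr.refl u)
    have h₂ := (hl u hu0 1 0 1 one_pos).2 (by simpa using hr.refl u)
    norm_num at h₁ h₂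
    exact le_antisymm h₁ h₂
  have hone : l 1 = 0 := by
    have := hmul (one_ne_zero (α := S)) one_ne_zero
    rw [mul_one] at this
    linarith
  have hpow : ∀ {z : S} (_ : z ≠ 0) (n : ℕ), l (z ^ n) = n * l z := by
    intro z hz n
    induction n with
    | zero => simp [hone]
    | succ n ih =>
      rw [pow_succ, hmul (pow_ne_zero n hz) hz, ih]
      push_cast
      ring
  have hle : ∀ {z w : S}, z ≠ 0 → w ≠ 0 → l z ≤ l w → ∀ n : ℕ, r (z ^ n) (u * w ^ n) := by
    intro z w hz hw h n
    have hwn := mul_ne_zero hu0 (pow_ne_zero n hw)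
    refine (htot _ _ (pow_ne_zero n hz) hwn).resolve_right fun h' => ?_
    have := hmono _ _ hwn (pow_ne_zero n hz) h'
    rw [hmul hu0 (pow_ne_zero n hw), hpow hw, hpow hz, hlu] at this
    have := mul_le_mul_of_nonneg_left h (Nat.cast_nonneg (α := ℝ) n)
    linarith
  refine ⟨l, ⟨hmul, fun {z w c} hz hw hc h => ?_⟩, hlu, hmono⟩
  refine sub_nonpos.1 (nonpos_of_forall_nat_mul_le (C := 1) fun n _ => ?_)
  have hz' := IsLogHom.add_ne_zero hS c hz
  have hw' := IsLogHom.add_ne_zero hS c hw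
  -- In the binomial expansion each term loses at most one factor `u`, a loss that vanishes after
  -- dividing logarithms by `n`.
  have h₁ : r ((z + c) ^ n) (u * (w + c) ^ n) := by
    rw [add_pow, add_pow, Finset.mul_sum]
    refine hr.sum _ _ _ fun i _ => ?_
    simp only [← mul_assoc]
    exact hr.mul_right _ (hr.mul_right _ (hle hz hw h i))
  have h₂ := hmono _ _ (pow_ne_zero n hz') (mul_ne_zero hu0 (pow_ne_zero n hw')) h₁
  rw [hmul hu0 (pow_ne_zero n hw'), hpow hz', hpow hw', hlu] at h₂
  linarith

end IsCancelPreorder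

variable [Nontrivial S] [Preorder S]

/-- A multiplicatively normalized log-homomorphism that is monotone on nonzero elements comes from
a nontrivial spectral homomorphism. -/
theorem not_spectralLT_of_isLogHom [IsPreorderedSemiring S] (hS : IsZerosumfree S) {l : S → ℝ}
    (hl : IsLogHom l) {u : S} (hu0 : u ≠ 0) (hlu : l u = 1)
    (hmono : ∀ a b, a ≠ 0 → b ≠ 0 → a ≤ b → l a ≤ l b) {x y : S} (hx : x ≠ 0) (hy : y ≠ 0)
    (hxy : l y ≤ l x) : ¬ SpectralLT x y := by
  rintro ⟨h₁, h₂, h₃, h₄⟩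
  -- The first inequality contradicts `l 2 < 0`, the second contradicts addition being min;
  -- `hnonpos` plays the same role for `l 2 > 0` and max.
  have hnonneg : ∀ {b : S}, b ≠ 0 → 0 ≤ b → l b ≤ l (b + b) ∧ l (b * u) ≤ l (b * u + b) := by
    intro b hb h
    have hbu := mul_ne_zero hb hu0
    have hadd := fun a => IsPreorderedSemiring.add_le_add_left' a 0 b h
    simp only [add_zero] at hadd
    exact ⟨hmono _ _ hb (IsLogHom.add_ne_zero hS b hb) (hadd b),
      hmono _ _ hbu (IsLogHom.add_ne_zero hS b hbu) (hadd _)⟩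
  have hnonpos : ∀ {b : S}, b ≠ 0 → b ≤ 0 → l (b + b) ≤ l b ∧ l (b + b * u) ≤ l b := by
    intro b hb h
    have hadd := fun a => IsPreorderedSemiring.add_le_add_left' b a 0
    simp only [add_zero] at hadd
    have hbu : b * u ≤ 0 := by
      simpa [mul_comm] using IsPreorderedSemiring.mul_le_mul_left' u b 0 h
    exact ⟨hmono _ _ (IsLogHom.add_ne_zero hS b hb) hb (hadd _ h),
      hmono _ _ (IsLogHom.add_ne_zero hS _ hb) hb (hadd _ hbu)⟩
  have hlbu : ∀ {b : S}, b ≠ 0 → l (b * u) = l b + 1 := fun hb => by rw [hl.map_mul hb hu0, hlu]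
  rcases lt_trichotomy (l 2) 0 with h2 | h2 | h2
  · obtain ⟨c, hc, φ, hφ⟩ := hl.neg.exists_nnrealHom hS (neg_pos.2 h2)
    have hφle : ∀ a b, a ≠ 0 → b ≠ 0 → l a ≤ l b → φ b ≤ φ a := by
      intro a b ha hb h
      rw [← NNReal.coe_le_coe, hφ a ha, hφ b hb, Real.exp_le_exp]
      exact mul_le_mul_of_nonneg_left (neg_le_neg h) hc.le
    refine absurd (hφle y x hy hx hxy) (not_le.2 (h₂ (RingHom.toOrderDual φ) ?_))
    refine isSpectralHom_of_ne_zero (fun a ha h => ?_)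
      (fun a b ha hb h => hφle a b ha hb (hmono a b ha hb h))
      (fun b hb h => ?_) (fun b hb h => zero_le (a := φ b))
    · have := hφ a ha
      rw [show φ a = 0 from h] at this
      exact (Real.exp_pos _).ne this
    · have := (hnonneg hb h).1
      rw [hl.map_add_self hS hb] at this
      linarith
  · rcases hl.max_or_min hS h2 with hmax | hmin
    · obtain ⟨φ, hφ⟩ := hl.exists_tropRealHom hS hmax
      have hφle : ∀ a b, a ≠ 0 → b ≠ 0 → l a ≤ l b → φ a ≤ φ b := by
        intro a b ha hb h
        rwa [TropReal.le_def, ← NNReal.coe_le_coe, hφ a ha, hφ b hb, Real.exp_le_exp]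
      refine absurd (hφle y x hy hx hxy) (not_le.2 (h₃ φ ?_ fun htriv => ?_))
      · refine isSpectralHom_of_ne_zero (fun a ha h => ?_)
          (fun a b ha hb h => hφle a b ha hb (hmono a b ha hb h))
          (fun b hb h => ?_) (fun b hb h => ?_)
        · have := hφ a ha
          rw [h] at this
          exact (Real.exp_pos _).ne this
        · rw [TropReal.le_def]
          exact zero_le
        · have := (hnonpos hb h).2
          rw [hmax _ _ hb (mul_ne_zero hb hu0), hlbu hb] at this
          linarith [le_max_right (l b) (l b + 1)]
      · have := hφ u hu0
        rw [htriv u hu0, hlu] at this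
        norm_num at this
        linarith [Real.add_one_lt_exp one_ne_zero]
    · obtain ⟨φ, hφ⟩ := hl.neg.exists_tropRealHom hS fun a b ha hb => by
        rw [hmin a b ha hb, max_neg_neg]
      have hφle : ∀ a b, a ≠ 0 → b ≠ 0 → l a ≤ l b → φ b ≤ φ a := by
        intro a b ha hb h
        rw [TropReal.le_def, ← NNReal.coe_le_coe, hφ a ha, hφ b hb, Real.exp_le_exp]
        exact neg_le_neg h
      refine absurd (hφle y x hy hx hxy)
        (not_le.2 (h₄ (RingHom.toOrderDual φ) ?_ fun htriv => ?_))
      · refine isSpectralHom_of_ne_zero (fun a ha h => ?_)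
          (fun a b ha hb h => hφle a b ha hb (hmono a b ha hb h))
          (fun b hb h => ?_) (fun b hb h => ?_)
        · have := hφ a ha
          rw [show φ a = 0 from h] at this
          exact (Real.exp_pos _).ne this
        · have := (hnonneg hb h).2
          rw [hmin _ _ (mul_ne_zero hb hu0) hb, hlbu hb] at this
          linarith [min_le_right (l b + 1) (l b)]
        · change (0 : TropReal) ≤ φ b
          rw [TropReal.le_def]
          exact zero_le
      · have := hφ u hu0
        rw [show φ u = 1 from htriv u hu0, hlu] at this
        have h' : Real.exp (-1) < 1 := Real.exp_lt_one_iff.2 (by norm_num)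
        norm_num at this
        linarith
  · obtain ⟨c, hc, φ, hφ⟩ := hl.exists_nnrealHom hS h2
    have hφle : ∀ a b, a ≠ 0 → b ≠ 0 → l a ≤ l b → φ a ≤ φ b := by
      intro a b ha hb h
      rw [← NNReal.coe_le_coe, hφ a ha, hφ b hb, Real.exp_le_exp]
      exact mul_le_mul_of_nonneg_left h hc.le
    refine absurd (hφle y x hy hx hxy) (not_le.2 (h₁ φ ?_))
    refine isSpectralHom_of_ne_zero (fun a ha h => ?_)
      (fun a b ha hb h => hφle a b ha hb (hmono a b ha hb h))
      (fun b hb h => zero_le) (fun b hb h => ?_)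
    · have := hφ a ha
      rw [h] at this
      exact (Real.exp_pos _).ne this
    · have := (hnonpos hb h).1
      rw [hl.map_add_self hS hb] at this
      linarith

/-- The preorder of the semifield of fractions. -/
theorem isCancelPreorder_exists_mul_le [IsPreorderedSemiring S] :
    IsCancelPreorder fun a b : S => ∃ c, c ≠ 0 ∧ c * a ≤ c * b where
  refl a := ⟨1, one_ne_zero, le_rfl⟩
  trans := by
    rintro a b e ⟨c, hc, h⟩ ⟨d, hd, h'⟩
    refine ⟨d * c, mul_ne_zero hd hc, ?_⟩
    have h₁ := IsPreorderedSemiring.mul_le_mul_left' d _ _ h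
    have h₂ := IsPreorderedSemiring.mul_le_mul_left' c _ _ h'
    calc d * c * a = d * (c * a) := mul_assoc _ _ _
      _ ≤ d * (c * b) := h₁
      _ = c * (d * b) := mul_left_comm _ _ _
      _ ≤ c * (d * e) := h₂
      _ = d * c * e := by ring
  add_right := by
    rintro e a b ⟨c, hc, h⟩
    refine ⟨c, hc, ?_⟩
    rw [mul_add, mul_add, add_comm _ (c * e), add_comm _ (c * e)]
    exact IsPreorderedSemiring.add_le_add_left' _ _ _ h
  mul_left := by
    rintro e a b ⟨c, hc, h⟩
    refine ⟨c, hc, ?_⟩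
    rw [mul_left_comm c, mul_left_comm c]
    exact IsPreorderedSemiring.mul_le_mul_left' _ _ _ h
  cancel := by
    rintro e a b he ⟨c, hc, h⟩
    exact ⟨c * e, mul_ne_zero hc he, by simpa only [mul_assoc] using h⟩

/-- Strict spectral inequalities yield a catalytic inequality with slack `u` between powers. -/
theorem exists_slack_of_spectralLT [IsPreorderedSemiring S] (hS : IsZerosumfree S) {u x y : S}
    (hu0 : u ≠ 0) (hu : 1 ≤ u) (hx : x ≠ 0) (hy : y ≠ 0)
    (hbdd : ∀ z : S, z ≠ 0 → ∃ k : ℕ, z ≤ u ^ k ∧ 1 ≤ u ^ k * z) (hxy : SpectralLT x y) :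
    ∃ n : ℕ, 0 < n ∧ ∃ a, a ≠ 0 ∧ a * (u * x ^ n) ≤ a * y ^ n := by
  by_contra! hcon
  have hle : ∀ a b : S, a ≤ b → ∃ c, c ≠ 0 ∧ c * a ≤ c * b := fun a b h =>
    ⟨1, one_ne_zero, by simpa using h⟩
  obtain ⟨r, hr, hle', htot, hn⟩ := isCancelPreorder_exists_mul_le.exists_total_extension hS
    (hle 1 u hu) (x := x) (y := y) fun n hn ⟨a, ha, h⟩ => hcon n hn a ha h
  have hext : ∀ {a b : S}, a ≤ b → r a b := fun h => hle' _ _ (hle _ _ h)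
  have hbdd' : ∀ z, z ≠ 0 → ∃ k : ℕ, r z (u ^ k) ∧ r 1 (u ^ k * z) := fun z hz =>
    (hbdd z hz).imp fun k h => ⟨hext h.1, hext h.2⟩
  -- If `u ≤ 1`, all nonzero elements become equivalent, and then `u * x ≤ y`.
  have hu' : ¬ r u 1 := by
    intro h
    have hpow : ∀ n, r (u ^ n) 1 := fun n => by simpa using hr.pow h n
    obtain ⟨i, hi, -⟩ := hbdd' (u * x ^ 1) (mul_ne_zero hu0 (pow_ne_zero 1 hx))
    obtain ⟨j, -, hj⟩ := hbdd' (y ^ 1) (pow_ne_zero 1 hy)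
    refine hn 1 one_pos (hr.trans (hr.trans hi (hpow i)) (hr.trans hj ?_))
    simpa only [one_mul] using hr.mul_right (y ^ 1) (hpow j)
  obtain ⟨l, hl, hlu, hmono⟩ := hr.exists_isLogHom hS hu0 (hext hu) hu' htot hbdd'
  refine not_spectralLT_of_isLogHom hS hl hu0 hlu
    (fun a b ha hb h => hmono a b ha hb (hext h)) hx hy ?_ hxy
  refine sub_nonpos.1 (nonpos_of_forall_nat_mul_le (C := 1) fun n hn0 => ?_)
  have hxn := mul_ne_zero hu0 (pow_ne_zero n hx)
  have h := hmono _ _ (pow_ne_zero n hy) hxn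
    ((htot _ _ hxn (pow_ne_zero n hy)).resolve_left (hn n hn0))
  rw [hl.map_mul hu0 (pow_ne_zero n hx), hl.map_pow hy, hl.map_pow hx, hlu] at h
  linarith

end Spectral

/-! ### Algebraic inequalities from and to spectral ones. -/

section Consequences

variable {S : Type*} [CommSemiring S] [Preorder S]

theorem map_le_map_of_mul_le {T : Type*} [CommSemiring T] [Preorder T] {x y : S}
    {φ : S →+* T} (hφ : IsSpectralHom φ)
    (hmul : ∀ a b c : T, c ≠ 0 → c * a ≤ c * b → a ≤ b)
    (hpow : ∀ (a b : T) (n : ℕ), 0 < n → a ^ n ≤ b ^ n → a ≤ b) {a : S} (ha : a ≠ 0) {n : ℕ}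
    (hn : 0 < n) (h : a * x ^ n ≤ a * y ^ n) : φ x ≤ φ y := by
  have h₁ := hφ.monotone h
  rw [map_mul, map_mul, map_pow, map_pow] at h₁
  exact hpow _ _ n hn (hmul _ _ _ (fun h0 => ha (hφ.eq_zero_of_map_eq_zero a h0)) h₁)

theorem TropReal.val_pow (a : TropReal) (n : ℕ) : (a ^ n).val = a.val ^ n := by
  induction n with
  | zero => simp
  | succ n ih => rw [pow_succ, pow_succ, TropReal.val_mul, ih]

/-- In all four codomains nonzero factors cancel and positive powers reflect the order. -/
theorem spectralLE_of_mul_pow_le {x y a : S} (ha : a ≠ 0) {n : ℕ} (hn : 0 < n)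
    (h : a * x ^ n ≤ a * y ^ n) : SpectralLE x y := by
  have hmul : ∀ a b c : ℝ≥0, c ≠ 0 → c * a ≤ c * b → a ≤ b := fun a b c hc h =>
    le_of_mul_le_mul_left h (pos_iff_ne_zero.2 hc)
  have hpow : ∀ (a b : ℝ≥0) (n : ℕ), 0 < n → a ^ n ≤ b ^ n → a ≤ b := fun a b n hn h =>
    le_of_pow_le_pow_left₀ hn.ne' zero_le h
  have hmul' : ∀ a b c : TropReal, c ≠ 0 → c * a ≤ c * b → a ≤ b := fun a b c hc h =>
    hmul a.val b.val c.val (fun h0 => hc (TropReal.ext h0)) h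
  have hpow' : ∀ (a b : TropReal) (n : ℕ), 0 < n → a ^ n ≤ b ^ n → a ≤ b := fun a b n hn h =>
    hpow a.val b.val n hn (by simpa only [TropReal.le_def, TropReal.val_pow] using h)
  exact ⟨fun φ hφ => map_le_map_of_mul_le hφ hmul hpow ha hn h,
    fun φ hφ => map_le_map_of_mul_le hφ (fun a b c hc h => hmul b a c hc h)
      (fun a b n hn h => hpow b a n hn h) ha hn h,
    fun φ hφ => map_le_map_of_mul_le hφ hmul' hpow' ha hn h,
    fun φ hφ => map_le_map_of_mul_le hφ (fun a b c hc h => hmul' b a c hc h)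
      (fun a b n hn h => hpow' b a n hn h) ha hn h⟩

variable [IsPreorderedSemiring S]

theorem mul_le_mul_of_semiring {a b c d : S} (h : a ≤ b) (h' : c ≤ d) : a * c ≤ b * d := by
  have h₁ := IsPreorderedSemiring.mul_le_mul_left' c a b h
  rw [mul_comm c, mul_comm c] at h₁
  exact h₁.trans (IsPreorderedSemiring.mul_le_mul_left' b c d h')

theorem pow_le_pow_of_semiring {a b : S} (h : a ≤ b) (n : ℕ) : a ^ n ≤ b ^ n := by
  induction n with
  | zero => simp
  | succ n ih => simpa only [pow_succ] using mul_le_mul_of_semiring ih h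

theorem pow_mono_of_semiring {u : S} (h : 1 ≤ u) {m n : ℕ} (hmn : m ≤ n) : u ^ m ≤ u ^ n := by
  obtain ⟨k, rfl⟩ := Nat.exists_eq_add_of_le hmn
  simpa [pow_add] using mul_le_mul_of_semiring (le_refl (u ^ m)) (pow_le_pow_of_semiring h k)

/-- The powers of `x` are eventually smaller than those of `y` by an arbitrary power of `u`, up to
a fixed power of `u`. -/
theorem exists_eventually_pow_mul_pow_le [NoZeroDivisors S] {u x y a : S}
    (hu : 1 ≤ u) (hx : x ≠ 0) (hy : y ≠ 0) (ha : a ≠ 0)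
    (hbdd : ∀ z : S, z ≠ 0 → ∃ k : ℕ, z ≤ u ^ k ∧ 1 ≤ u ^ k * z) {m : ℕ} (hm : 0 < m)
    (h : a * (u * x ^ m) ≤ a * y ^ m) :
    ∃ K : ℕ, ∀ n : ℕ, ∀ᶠ N in Filter.atTop, u ^ n * x ^ N ≤ u ^ K * y ^ N := by
  have : Nontrivial S := ⟨⟨x, 0, hx⟩⟩
  obtain ⟨k, hk, hk'⟩ := hbdd a ha
  obtain ⟨i, hi, -⟩ := hbdd x hx
  obtain ⟨j, -, hj⟩ := hbdd y hy
  have hxy : x ≤ u ^ (i + j) * y := by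
    rw [pow_add, mul_assoc]
    simpa using mul_le_mul_of_semiring hi hj
  have hpow : ∀ q : ℕ, a * (u * x ^ m) ^ q ≤ a * (y ^ m) ^ q := by
    intro q
    induction q with
    | zero => simp
    | succ q ih =>
      calc a * (u * x ^ m) ^ (q + 1) = (u * x ^ m) * (a * (u * x ^ m) ^ q) := by ring
        _ ≤ (u * x ^ m) * (a * (y ^ m) ^ q) := IsPreorderedSemiring.mul_le_mul_left' _ _ _ ih
        _ = (y ^ m) ^ q * (a * (u * x ^ m)) := by ring
        _ ≤ (y ^ m) ^ q * (a * y ^ m) := IsPreorderedSemiring.mul_le_mul_left' _ _ _ h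
        _ = a * (y ^ m) ^ (q + 1) := by ring
  have hpow' : ∀ q : ℕ, (u * x ^ m) ^ q ≤ u ^ (k + k) * (y ^ m) ^ q := by
    intro q
    calc (u * x ^ m) ^ q = 1 * (u * x ^ m) ^ q := (one_mul _).symm
      _ ≤ u ^ k * a * (u * x ^ m) ^ q := mul_le_mul_of_semiring hk' le_rfl
      _ = u ^ k * (a * (u * x ^ m) ^ q) := mul_assoc _ _ _
      _ ≤ u ^ k * (a * (y ^ m) ^ q) := IsPreorderedSemiring.mul_le_mul_left' _ _ _ (hpow q)
      _ ≤ u ^ k * (u ^ k * (y ^ m) ^ q) :=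
          IsPreorderedSemiring.mul_le_mul_left' _ _ _ (mul_le_mul_of_semiring hk le_rfl)
      _ = _ := by ring
  -- `k + k` pays for removing the catalyst `a`, and `(i + j) * m` for the remainder `N % m`;
  -- neither depends on `n`. The threshold `m * n` ensures `n ≤ N / m`.
  refine ⟨k + k + (i + j) * m, fun n => Filter.eventually_atTop.2 ⟨m * n, fun N hN => ?_⟩⟩
  have hq : n ≤ N / m := (Nat.le_div_iff_mul_le hm).2 (by rwa [mul_comm])
  have hrem : (i + j) * (N % m) ≤ (i + j) * m := Nat.mul_le_mul_left _ (Nat.mod_lt N hm).le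
  have hN : N = m * (N / m) + N % m := (Nat.div_add_mod N m).symm
  calc u ^ n * x ^ N ≤ u ^ (N / m) * x ^ N :=
        mul_le_mul_of_semiring (pow_mono_of_semiring hu hq) le_rfl
    _ = (u * x ^ m) ^ (N / m) * x ^ (N % m) := by
        conv_lhs => rw [hN]
        rw [Nat.mul_add_div hm, Nat.div_eq_of_lt (Nat.mod_lt N hm)]
        ring
    _ ≤ u ^ (k + k) * (y ^ m) ^ (N / m) * (u ^ (i + j) * y) ^ (N % m) :=
        mul_le_mul_of_semiring (hpow' _) (pow_le_pow_of_semiring hxy _)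
    _ = u ^ (k + k + (i + j) * (N % m)) * y ^ (m * (N / m) + N % m) := by ring
    _ ≤ u ^ (k + k + (i + j) * m) * y ^ (m * (N / m) + N % m) :=
        mul_le_mul_of_semiring (pow_mono_of_semiring hu (by omega)) le_rfl
    _ = _ := by rw [← hN]

/-- Telescoping: the two products share every term except `x ^ (n + 1)` and `y ^ (n + 1)`. -/
theorem homogeneous_sum_mul_le {x y v : S} {n : ℕ} (h : v * x ^ (n + 1) ≤ v * y ^ (n + 1)) :
    (v * ∑ j ∈ Finset.range (n + 1), x ^ j * y ^ (n - j)) * x ≤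
      (v * ∑ j ∈ Finset.range (n + 1), x ^ j * y ^ (n - j)) * y := by
  have h₁ : (∑ j ∈ Finset.range (n + 1), x ^ j * y ^ (n - j)) * x =
      ∑ j ∈ Finset.range n, x ^ (j + 1) * y ^ (n - j) + x ^ (n + 1) := by
    rw [Finset.sum_range_succ, add_mul, Finset.sum_mul, Nat.sub_self, pow_zero, mul_one, ← pow_succ]
    congr 1
    exact Finset.sum_congr rfl fun j _ => by ring
  have h₂ : (∑ j ∈ Finset.range (n + 1), x ^ j * y ^ (n - j)) * y =
      ∑ j ∈ Finset.range n, x ^ (j + 1) * y ^ (n - j) + y ^ (n + 1) := by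
    rw [Finset.sum_range_succ', add_mul, Finset.sum_mul, Nat.sub_zero, pow_zero, one_mul,
      ← pow_succ]
    congr 1
    refine Finset.sum_congr rfl fun j hj => ?_
    have : n - j = n - (j + 1) + 1 := by have := Finset.mem_range.1 hj; omega
    rw [this, pow_succ y, mul_assoc]
  rw [mul_assoc, mul_assoc, h₁, h₂, mul_add, mul_add]
  exact IsPreorderedSemiring.add_le_add_left' _ _ _ h

end Consequences

theorem mainTheorem4 {S : Type*} [CommSemiring S] [Preorder S] [IsPreorderedSemidomain S]
    (hS : IsZerosumfree S) (u : S) (hu0 : u ≠ 0) (hu : IsPowerUniversal u)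
    (x y : S) (hx : x ≠ 0) (hy : y ≠ 0) :
    -- algebraic inequalities imply the non-strict spectral inequalities
    (((∃ a : S, a ≠ 0 ∧ a * x ≤ a * y) ∨
        (∃ k n : ℕ, 0 < n ∧ u ^ k * x ^ n ≤ u ^ k * y ^ n)) →
      SpectralLE x y) ∧
    -- the strict spectral inequalities imply the algebraic inequalities
    ((∀ z : S, z ≠ 0 → ∃ k : ℕ, z ≤ u ^ k ∧ 1 ≤ u ^ k * z) →
      SpectralLT x y →
      (∃ k : ℕ, ∀ᶠ n : ℕ in Filter.atTop, u ^ k * x ^ n ≤ u ^ k * y ^ n) ∧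
      (IsPowerUniversal y → ∀ᶠ n : ℕ in Filter.atTop, x ^ n ≤ y ^ n) ∧
      (∃ a : S, a ≠ 0 ∧ a * x ≤ a * y) ∧
      (∃ k : ℕ, ∀ᶠ n : ℕ in Filter.atTop,
        u ^ k * (∑ j ∈ Finset.range (n + 1), x ^ j * y ^ (n - j)) ≠ 0 ∧
        (u ^ k * ∑ j ∈ Finset.range (n + 1), x ^ j * y ^ (n - j)) * x ≤
          (u ^ k * ∑ j ∈ Finset.range (n + 1), x ^ j * y ^ (n - j)) * y)) := by
  have : NoZeroDivisors S := ⟨fun {a b} h => IsPreorderedSemidomain.eq_zero_or_eq_zero a b h⟩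
  have : Nontrivial S := ⟨⟨1, 0, IsPreorderedSemidomain.one_ne_zero'⟩⟩
  refine ⟨?_, fun hbdd hxy => ?_⟩
  · rintro (⟨a, ha, h⟩ | ⟨k, n, hn, h⟩)
    · exact spectralLE_of_mul_pow_le ha one_pos (by simpa using h)
    · exact spectralLE_of_mul_pow_le (pow_ne_zero k hu0) hn h
  obtain ⟨m, hm, a, ha, h⟩ := exists_slack_of_spectralLT hS hu0 hu.1 hx hy hbdd hxy
  obtain ⟨K, hK⟩ := exists_eventually_pow_mul_pow_le hu.1 hx hy ha hbdd hm h
  have hsum : ∀ᶠ n : ℕ in Filter.atTop,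
      u ^ K * (∑ j ∈ Finset.range (n + 1), x ^ j * y ^ (n - j)) ≠ 0 ∧
      (u ^ K * ∑ j ∈ Finset.range (n + 1), x ^ j * y ^ (n - j)) * x ≤
        (u ^ K * ∑ j ∈ Finset.range (n + 1), x ^ j * y ^ (n - j)) * y := by
    filter_upwards [(Filter.tendsto_add_atTop_nat 1).eventually (hK K)] with n hn
    refine ⟨mul_ne_zero (pow_ne_zero K hu0) ?_, homogeneous_sum_mul_le hn⟩
    rw [Finset.sum_range_succ, Nat.sub_self, pow_zero, mul_one]
    exact fun h0 => pow_ne_zero n hx (hS _ _ h0).2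
  refine ⟨⟨K, hK K⟩, fun hyu => ?_, ?_, K, hsum⟩
  · obtain ⟨k, hk⟩ := hyu.2 1 u one_ne_zero hu0 hu.1
    rw [mul_one] at hk
    -- As `u ≤ y ^ k`, the factor `u ^ K` costs `k * K` extra powers of `y`; the matching powers of
    -- `x` are absorbed by the slack `u ^ c`.
    obtain ⟨c, hc, -⟩ := hbdd (x ^ (k * K)) (pow_ne_zero _ hx)
    obtain ⟨N₀, hN₀⟩ := Filter.eventually_atTop.1 (hK c)
    refine Filter.eventually_atTop.2 ⟨k * K + N₀, fun N hN => ?_⟩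
    obtain ⟨M, rfl⟩ := Nat.exists_eq_add_of_le (le_of_add_le_left hN)
    calc x ^ (k * K + M) = x ^ (k * K) * x ^ M := pow_add _ _ _
      _ ≤ u ^ c * x ^ M := mul_le_mul_of_semiring hc le_rfl
      _ ≤ u ^ K * y ^ M := hN₀ M (by omega)
      _ ≤ (y ^ k) ^ K * y ^ M := mul_le_mul_of_semiring (pow_le_pow_of_semiring hk K) le_rfl
      _ = y ^ (k * K + M) := by rw [← pow_mul, ← pow_add]
  · obtain ⟨n, hn⟩ := hsum.exists
    exact ⟨_, hn⟩
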